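/- Let $\overline{\mathbf{Q}}$ be an algebraic closure of $\mathbf{Q}$, let $h$ be the absolute logarithmic Weil height on $\mathbf{P}^1(\overline{\mathbf{Q}})=\overline{\mathbf{Q}}\cup\{\infty\}$ (with $h(\infty)=0$), and let $p$ be a place of $\mathbf{Q}$, that is, a prime number or $p=\infty$. If $p$ is a prime, let $L_p\subset\mathbf{C}_p$ be a Galois extension of $\mathbf{Q}_p$ of finite degree, where $\mathbf{C}_p$ is the completion of an algebraic closure of $\mathbf{Q}_p$; if $p=\infty$, let $L_\infty=\mathbf{R}\subset\mathbf{C}_\infty=\mathbf{C}$. An algebraic number $\alpha\in\overline{\mathbf{Q}}$ is called totally $L_p$ if all of its Galois conjugates over $\mathbf{Q}$ lie in $L_p$ under every embedding $\overline{\mathbf{Q}}\hookrightarrow\mathbf{C}_p$; the point $\infty$ is also regarded as totally $L_p$. Then $$\liminf_{\substack{\alpha\in\mathbf{P}^1(\overline{\mathbf{Q}})\\ \alpha\text{ is totally }L_p}} h(\alpha)>0,$$ where the limit inferior is taken along the cofinite subsets of the set of totally $L_p$ points; that is, for some $\varepsilon>0$ only finitely many totally $L_p$ points $\alpha$ satisfy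 $h(\alpha)<\varepsilon$. In particular there is a constant $c>0$, depending only on $L_p$, such that $h(\alpha)\ge c$ for every totally $L_p$ number $\alpha\in\overline{\mathbf{Q}}$ that is neither zero nor a root of unity. (The case $L_\infty=\mathbf{R}$ concerns the totally real numbers, and the case $L_p=\mathbf{Q}_p$ the totally $p$-adic numbers.) -/

import Mathlib

/-- The absolute logarithmic Weil height on the projective line
`ℙ¹(ℚ̄) = ℚ̄ ∪ {∞}`; the point `∞ = [1 : 0]` has height `0`. -/
noncomputable def weilHeightP1 (x : OnePoint (AlgebraicClosure ℚ)) : ℝ :=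
  x.elim 0 NumberField.absLogHeight₁

/-- An algebraic number `α` is totally `L`, for a subfield `L` of a field `C`, if every Galois
conjugate of `α` over `ℚ` lies in `L` under every embedding of the algebraic closure of `ℚ`
into `C`. -/
def IsTotally {C : Type*} [Field C] (L : Subfield C) (α : AlgebraicClosure ℚ) : Prop :=
  ∀ (σ : AlgebraicClosure ℚ →+* C) (τ : AlgebraicClosure ℚ ≃ₐ[ℚ] AlgebraicClosure ℚ),
    σ (τ α) ∈ L

/-- The set of totally `L` points of `ℙ¹(ℚ̄)`: the totally `L` numbers together with the
`ℚ`-rational point `∞`. -/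
def totallyPoints {C : Type*} [Field C] (L : Subfield C) :
    Set (OnePoint (AlgebraicClosure ℚ)) :=
  {x | ∀ α : AlgebraicClosure ℚ, x = (α : OnePoint (AlgebraicClosure ℚ)) → IsTotally L α}

/-- The limit inferior of a real-valued function `h` over the points of a set `S`: the limit
inferior of `h` along the filter of cofinite subsets of `S`, in the extended reals. -/
noncomputable def liminfOver {X : Type*} (S : Set X) (h : X → ℝ) : EReal :=
  Filter.liminf (fun x => (h x : EReal)) (Filter.cofinite ⊓ Filter.principal S)

/-- The field of real numbers as a subfield of the complex numbers. -/
noncomputable def realSubfield : Subfield ℂ := Complex.ofRealHom.fieldRange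

/-! Exponents `b < a` are chosen so that `x ^ a - x ^ b` is small, relative to `max |x| 1 ^ (a +
b)`, for all `x` in the local field. If `α ^ a ≠ α ^ b`, the product formula for `β = α ^ a - α ^ b`
in `ℚ(α)` (`two_le_mulHeight_pow`) weighs this gain at the places above `p` against trivial bounds
elsewhere, and gives `log 2 / (a + b) ≤ h(α)`. The exceptions are roots of `X ^ a - X ^ b`: finitely
many, each zero or a root of unity. Over `ℝ`, `x ^ 3 - x` suffices. Over `L_p`, compactness of the
unit ball supplies `a` and `b` (`exists_norm_pow_sub_pow_le`). -/

open NumberField IsDedekindDomain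

/-! ### Height bounds from the product formula -/

/-- The product formula turns uniform upper bounds for the absolute values of `β` at all places
into a lower bound for the height of `x`. -/
theorem NumberField.two_le_mulHeight_pow {K : Type*} [Field K] [NumberField K] {x β : K}
    (hβ : β ≠ 0) {C : ℝ} {g N : ℕ} (hC : 0 < C) (hg : 2 * C ≤ g)
    (hinf : ∀ w : InfinitePlace K, w β ≤ C * max (w x) 1 ^ N)
    (hfin : ∀ w : FinitePlace K, w β ≤ w (g : K) * max (w x) 1 ^ N) :
    2 ^ Module.finrank ℚ K ≤ Height.mulHeight₁ x ^ N := by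
  have hg0 : (0 : ℝ) < g := by linarith
  have hgK : (g : K) ≠ 0 := by
    have : g ≠ 0 := by rintro rfl; simp at hg0
    exact_mod_cast this
  set d := Module.finrank ℚ K
  have hs : (fun w : FinitePlace K ↦ max (w x) 1).HasFiniteMulSupport := by
    rcases eq_or_ne x 0 with rfl | hx
    · simp [Function.HasFiniteMulSupport]
    · have := FinitePlace.hasFiniteMulSupport hx
      exact this.subset fun w hw h ↦ hw (by simp_all)
  have h1 : ∏ w : InfinitePlace K, w β ^ w.mult ≤
      C ^ d * (∏ w : InfinitePlace K, max (w x) 1 ^ w.mult) ^ N := by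
    calc _ ≤ ∏ w : InfinitePlace K, (C * max (w x) 1 ^ N) ^ w.mult := by
            gcongr with w; exact hinf w
      _ = _ := by
        simp_rw [mul_pow, Finset.prod_mul_distrib, Finset.prod_pow_eq_pow_sum,
          InfinitePlace.sum_mult_eq, ← pow_mul, mul_comm N, pow_mul, Finset.prod_pow]
        rfl
  -- The factors `w g` multiply to `g ^ (-d)`; against `C ^ d` from the infinite places, `2 * C ≤ g`
  -- leaves a net gain `2 ^ (-d)`.
  have h2 : ∏ᶠ w : FinitePlace K, w β ≤
      ((g : ℝ) ^ d)⁻¹ * (∏ᶠ w : FinitePlace K, max (w x) 1) ^ N := by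
    have hgs := FinitePlace.hasFiniteMulSupport hgK
    calc _ ≤ ∏ᶠ w : FinitePlace K, w (g : K) * max (w x) 1 ^ N :=
            finprod_le_finprod (FinitePlace.hasFiniteMulSupport hβ) (fun w ↦ apply_nonneg w β)
              (by fun_prop) hfin
      _ = _ := by
        rw [finprod_mul_distrib hgs (by fun_prop), finprod_pow hs,
          FinitePlace.prod_eq_inv_abs_norm hgK,
          show (g : K) = algebraMap ℚ K g by simp, Algebra.norm_algebraMap]
        simp [d]
  have h3 := prod_abs_eq_one hβ
  rw [mulHeight₁_eq, mul_pow]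
  set A := (∏ w : InfinitePlace K, max (w x) 1 ^ w.mult) ^ N
  set B := (∏ᶠ w : FinitePlace K, max (w x) 1) ^ N
  have hA : 0 ≤ A := by positivity
  have h4 : 1 ≤ (C ^ d * A) * (((g : ℝ) ^ d)⁻¹ * B) := by
    rw [← h3]
    gcongr
    exact finprod_nonneg fun w ↦ apply_nonneg w β
  have h5 : (g : ℝ) ^ d ≤ C ^ d * (A * B) := by
    have hgd : (0 : ℝ) < g ^ d := by positivity
    calc (g : ℝ) ^ d = g ^ d * 1 := by ring
      _ ≤ g ^ d * ((C ^ d * A) * (((g : ℝ) ^ d)⁻¹ * B)) := by gcongr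
      _ = _ := by field_simp
  have h6 : (2 * C) ^ d ≤ C ^ d * (A * B) := (pow_le_pow_left₀ (by positivity) hg d).trans h5
  rw [mul_pow, mul_comm] at h6
  exact le_of_mul_le_mul_left h6 (by positivity)

theorem log_two_div_le_absLogHeight₁ {α : AlgebraicClosure ℚ} {N : ℕ} (hN : 0 < N)
    (h : ∀ [NumberField (IntermediateField.adjoin ℚ {α})],
      2 ^ Module.finrank ℚ (IntermediateField.adjoin ℚ {α}) ≤
        Height.mulHeight₁ (IntermediateField.AdjoinSimple.gen ℚ α) ^ N) :
    Real.log 2 / N ≤ absLogHeight₁ α := by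
  have hα : IsIntegral ℚ α := (AlgebraicClosure.isAlgebraic ℚ).isAlgebraic α |>.isIntegral
  have : FiniteDimensional ℚ (IntermediateField.adjoin ℚ {α}) :=
    IntermediateField.adjoin.finiteDimensional hα
  have : NumberField (IntermediateField.adjoin ℚ {α}) := {}
  have h := @h _
  rw [absLogHeight₁, absMulHeight₁, dif_pos hα, Real.log_rpow (Height.mulHeight₁_pos _)]
  have hl := Real.log_le_log (by positivity) h
  rw [Real.log_pow, Real.log_pow] at hl
  have hd : (0 : ℝ) < Module.finrank ℚ (IntermediateField.adjoin ℚ {α}) := by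
    exact_mod_cast Module.finrank_pos
  have hN' : (0 : ℝ) < N := by exact_mod_cast hN
  rw [inv_mul_eq_div, div_le_div_iff₀ hN' hd]
  linarith

theorem liminfOver_pos_and_exists_bound {C : Type*} [Field C] (L : Subfield C) {a b : ℕ}
    (hba : b < a) {c : ℝ} (hc : 0 < c)
    (h : ∀ α : AlgebraicClosure ℚ, IsTotally L α → α ^ a ≠ α ^ b → c ≤ absLogHeight₁ α) :
    0 < liminfOver (totallyPoints L) weilHeightP1 ∧
      ∃ c : ℝ, 0 < c ∧ ∀ α : AlgebraicClosure ℚ, IsTotally L α →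
        α ≠ 0 → (∀ n : ℕ, 0 < n → α ^ n ≠ 1) → c ≤ absLogHeight₁ α := by
  refine ⟨(EReal.coe_pos.2 hc).trans_le ?_, c, hc, fun α hα h0 h1 ↦ h α hα fun hab ↦ ?_⟩
  · refine Filter.le_liminf_of_le (by isBoundedDefault) ?_
    rw [Filter.eventually_inf_principal, Filter.eventually_cofinite]
    have hf : {α : AlgebraicClosure ℚ | α ^ a = α ^ b}.Finite := by
      have hp : (Polynomial.X ^ a - Polynomial.X ^ b : Polynomial (AlgebraicClosure ℚ)) ≠ 0 := by
        intro h
        have := congrArg (Polynomial.coeff · a) h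
        simp [Polynomial.coeff_X_pow, hba.ne'] at this
      refine (Polynomial.finite_setOfPred_isRoot hp).subset fun α hα ↦ ?_
      simpa [sub_eq_zero] using hα
    refine ((hf.image ((↑) : _ → OnePoint (AlgebraicClosure ℚ))).insert OnePoint.infty).subset ?_
    intro x hx
    induction x using OnePoint.rec with
    | infty => simp
    | coe α =>
      right
      refine ⟨α, ?_, rfl⟩
      by_contra hab
      exact hx fun hS ↦ by
        have := h α (hS α rfl) hab
        simpa [weilHeightP1] using this
  · have : α ^ b * α ^ (a - b) = α ^ b * 1 := by
      rw [← pow_add, Nat.add_sub_cancel' hba.le, mul_one, hab]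
    exact h1 (a - b) (by omega) (mul_left_cancel₀ (pow_ne_zero _ h0) this)

theorem FinitePlace.apply_pow_sub_pow_le {K : Type*} [Field K] [NumberField K] (w : FinitePlace K)
    (x : K) {a b N : ℕ} (ha : a ≤ N) (hb : b ≤ N) : w (x ^ a - x ^ b) ≤ max (w x) 1 ^ N := by
  have key (n : ℕ) (hn : n ≤ N) : w (x ^ n) ≤ max (w x) 1 ^ N := by
    rw [map_pow]
    calc w x ^ n ≤ max (w x) 1 ^ n := by
          gcongr
          exact le_max_left _ _
      _ ≤ _ := pow_le_pow_right₀ (le_max_right _ _) hn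
  rw [sub_eq_add_neg]
  refine (FinitePlace.add_le w _ _).trans (max_le (key a ha) ?_)
  rw [map_neg_eq_map]
  exact key b hb

/-- Since `C` is algebraically closed, `σ` extends to the algebraic closure of `ℚ`, where the
hypothesis on `α` applies. -/
theorem IsTotally.apply_gen_mem {C : Type*} [Field C] [IsAlgClosed C] {L : Subfield C}
    {α : AlgebraicClosure ℚ} (hα : IsTotally L α) (σ : IntermediateField.adjoin ℚ {α} →+* C) :
    σ (IntermediateField.AdjoinSimple.gen ℚ α) ∈ L := by
  let := σ.toAlgebra
  have : Algebra.IsAlgebraic ℚ (AlgebraicClosure ℚ) := AlgebraicClosure.isAlgebraic ℚ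
  have : Algebra.IsAlgebraic (IntermediateField.adjoin ℚ {α}) (AlgebraicClosure ℚ) :=
    Algebra.IsAlgebraic.tower_top (K := ℚ) _
  let f : AlgebraicClosure ℚ →ₐ[IntermediateField.adjoin ℚ {α}] C := IsAlgClosed.lift
  have h1 := f.commutes (IntermediateField.AdjoinSimple.gen ℚ α)
  rw [IntermediateField.AdjoinSimple.algebraMap_gen] at h1
  have h2 : f α ∈ L := hα f.toRingHom 1
  rwa [h1] at h2

/-! ### The totally real case -/

theorem log_two_div_four_le_of_totally_real {α : AlgebraicClosure ℚ} (hα : IsTotally realSubfield α)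
    (h : α ^ 3 ≠ α ^ 1) : Real.log 2 / 4 ≤ absLogHeight₁ α := by
  refine log_two_div_le_absLogHeight₁ (N := 4) (by norm_num) ?_
  intro _
  set K := IntermediateField.adjoin ℚ {α}
  set x := IntermediateField.AdjoinSimple.gen ℚ α
  have hx : algebraMap K (AlgebraicClosure ℚ) x = α :=
    IntermediateField.AdjoinSimple.algebraMap_gen ℚ α
  have hβ : x ^ 3 - x ^ 1 ≠ 0 := fun h0 ↦ h <| by
    rw [← hx, ← map_pow, ← map_pow, sub_eq_zero.1 h0]
  -- The whole gain is archimedean. Exponent 4 = 3 + 1 is needed: with 3 the ratio tends to 1 as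
  -- `|x| → ∞`.
  refine two_le_mulHeight_pow hβ (C := 1 / 2) (g := 1) (by norm_num) (by norm_num)
    (fun w ↦ ?_) fun w ↦ ?_
  swap
  · simpa using FinitePlace.apply_pow_sub_pow_le w x (a := 3) (b := 1) (N := 4)
      (by norm_num) (by norm_num)
  obtain ⟨r, hr⟩ : ∃ r : ℝ, (r : ℂ) = w.embedding x := by
    exact hα.apply_gen_mem w.embedding
  have e1 : w x = |r| := by
    rw [← InfinitePlace.norm_embedding_eq, ← hr, Complex.norm_real, Real.norm_eq_abs]
  have e2 : w (x ^ 3 - x ^ 1) = |r| * |r ^ 2 - 1| := by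
    rw [← InfinitePlace.norm_embedding_eq, map_sub, map_pow, map_pow, ← hr, ← abs_mul,
      ← Real.norm_eq_abs, ← Complex.norm_real]
    congr 1
    push_cast
    ring
  rw [e1, e2, ← sq_abs r]
  have ht := abs_nonneg r
  generalize |r| = t at ht
  rcases le_total t 1 with h1 | h1
  · rw [max_eq_right h1, abs_of_nonpos (by nlinarith)]
    nlinarith [mul_nonneg ht (sq_nonneg (t - 1 / 2)), sq_nonneg (t - 1 / 2)]
  · rw [max_eq_left h1, abs_of_nonneg (by nlinarith)]
    have : 0 ≤ t ^ 3 / 2 - t ^ 2 + 1 := by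
      -- The cubic has its minimum on `t ≥ 0` at `4 / 3`.
      nlinarith [mul_nonneg ht (sq_nonneg (t - 4 / 3)), sq_nonneg (t - 4 / 3)]
    nlinarith

/-! ### Finite places above `p` and embeddings into `ℂ_[p]` -/

section padic

variable {p : ℕ} [Fact p.Prime]

open scoped NNReal

theorem PadicComplex.norm_le_one_of_isIntegral {x : ℂ_[p]} 
    (hx : IsIntegral ℤ x) : ‖x‖ ≤ 1 := by
  have h := (Valuation.integer.integers (NormedField.valuation (K := ℂ_[p]))).mem_of_integral
    (x := x) hx.tower_top
  exact h

/-- The prime ideal of the ring of integers cut out by an embedding into `ℂ_[p]`. -/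
def primeOfEmbedding {K : Type*} [Field K] (σ : K →+* ℂ_[p]) : Ideal (𝓞 K) where
  carrier := {x | ‖σ x‖ < 1}
  zero_mem' := by simp
  add_mem' {x y} hx hy := by
    simp only [Set.mem_ofPred_eq, map_add] at *
    exact (PadicComplex.isNonarchimedean p _ _).trans_lt (max_lt hx hy)
  smul_mem' c {x} hx := by
    simp only [Set.mem_ofPred_eq, smul_eq_mul, map_mul, norm_mul] at *
    have := PadicComplex.norm_le_one_of_isIntegral (p := p) (x := σ c) (by
      convert map_isIntegral_int σ c.isIntegral_coe
      exact Subsingleton.elim _ _)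
    exact (mul_le_of_le_one_left (norm_nonneg _) this).trans_lt hx

theorem mem_primeOfEmbedding {K : Type*} [Field K] {σ : K →+* ℂ_[p]} {x : 𝓞 K} :
    x ∈ primeOfEmbedding σ ↔ ‖σ x‖ < 1 := Iff.rfl

theorem primeOfEmbedding_isPrime {K : Type*} [Field K] (σ : K →+* ℂ_[p]) :
    (primeOfEmbedding σ).IsPrime := by
  refine ⟨fun h ↦ ?_, fun {x y} hxy ↦ ?_⟩
  · have : (1 : 𝓞 K) ∈ primeOfEmbedding σ := h ▸ trivial
    simp [mem_primeOfEmbedding] at this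
  · by_contra! h
    simp only [mem_primeOfEmbedding, not_lt, map_mul, norm_mul] at h hxy
    exact (one_le_mul_of_one_le_of_one_le h.1 h.2).not_gt hxy

theorem PadicComplex.norm_intCast_lt_one_iff {n : ℤ} : ‖(n : ℂ_[p])‖ < 1 ↔ (p : ℤ) ∣ n := by
  rw [← Padic.norm_intCast_lt_one_iff, ← map_intCast (algebraMap ℚ_[p] ℂ_[p]) n,
    norm_algebraMap']

/-- Otherwise prime avoidance yields `x ∈ v` with `‖σ x‖ ≥ 1` for every `σ`. Its norm, the product
of the `σ x`, is then prime to `p`; as `v` contains both, `1 ∈ v`. -/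
theorem exists_primeOfEmbedding_eq {K : Type*} [Field K] [NumberField K]
    (v : HeightOneSpectrum (𝓞 K)) (hv : (p : 𝓞 K) ∈ v.asIdeal) :
    ∃ σ : K →+* ℂ_[p], v.asIdeal = primeOfEmbedding σ := by
  have : v.asIdeal.IsMaximal := v.isMaximal
  suffices h : ∃ σ : K →ₐ[ℚ] ℂ_[p], v.asIdeal ≤ primeOfEmbedding (σ : K →+* ℂ_[p]) by
    obtain ⟨σ, hσ⟩ := h
    exact ⟨σ, this.eq_of_le (primeOfEmbedding_isPrime _).ne_top hσ⟩
  let σ₀ : K →ₐ[ℚ] ℂ_[p] := IsAlgClosed.lift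
  by_contra! h
  have hnot : ¬ ((v.asIdeal : Set (𝓞 K)) ⊆
      ⋃ σ ∈ (↑(Finset.univ : Finset (K →ₐ[ℚ] ℂ_[p])) : Set (K →ₐ[ℚ] ℂ_[p])),
        (primeOfEmbedding (σ : K →+* ℂ_[p]) : Set (𝓞 K))) := by
    -- `σ₀` only fills the two index slots that prime avoidance exempts from primality.
    have := (Ideal.subset_union_prime (s := (Finset.univ : Finset (K →ₐ[ℚ] ℂ_[p])))
      (f := fun σ ↦ primeOfEmbedding (σ : K →+* ℂ_[p])) (I := v.asIdeal) σ₀ σ₀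
      (fun σ _ _ _ ↦ primeOfEmbedding_isPrime _)).not
    rw [this]
    rintro ⟨σ, -, hσ⟩
    exact h σ hσ
  obtain ⟨x, hxv, hx⟩ := Set.not_subset.1 hnot
  simp only [Finset.coe_univ, Set.mem_univ, Set.iUnion_true, Set.mem_iUnion, SetLike.mem_coe,
    not_exists, mem_primeOfEmbedding, not_lt] at hx
  have h1 : 1 ≤ ‖((Algebra.norm ℤ x : ℤ) : ℂ_[p])‖ := by
    have := Algebra.norm_eq_prod_embeddings ℚ ℂ_[p] (x : K)
    rw [← Algebra.coe_norm_int] at this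
    have h2 : ((Algebra.norm ℤ x : ℤ) : ℂ_[p]) = ∏ σ : K →ₐ[ℚ] ℂ_[p], σ x := by
      rw [← this]; simp
    rw [h2, norm_prod]
    rw [← Finset.prod_const_one (s := (Finset.univ : Finset (K →ₐ[ℚ] ℂ_[p])))]
    exact Finset.prod_le_prod (fun _ _ ↦ zero_le_one) fun σ _ ↦ hx σ
  refine h1.not_gt (PadicComplex.norm_intCast_lt_one_iff.2 ?_)
  have h3 : ((Algebra.norm ℤ x : ℤ) : 𝓞 K) ∈ v.asIdeal := by
    have := Ideal.absNorm_mem (Ideal.span {x})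
    rw [Ideal.absNorm_span_singleton] at this
    have h4 : (((Algebra.norm ℤ x).natAbs : ℕ) : 𝓞 K) ∈ v.asIdeal :=
      (Ideal.span_singleton_le_iff_mem _).2 hxv this
    rcases Int.natAbs_eq (Algebra.norm ℤ x) with h5 | h5
    · rw [h5, Int.cast_natCast]
      exact h4
    · rw [h5, Int.cast_neg, Int.cast_natCast]
      exact neg_mem h4
  by_contra hd
  have hco : IsCoprime (p : ℤ) (Algebra.norm ℤ x) :=
    (Prime.coprime_iff_not_dvd (Nat.prime_iff_prime_int.1 Fact.out)).2 hd
  obtain ⟨a, b, hab⟩ := hco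
  apply v.isPrime.ne_top
  rw [Ideal.eq_top_iff_one]
  have : (1 : 𝓞 K) = a * p + b * (Algebra.norm ℤ x : ℤ) := by
    exact_mod_cast congrArg (Int.cast : ℤ → 𝓞 K) hab.symm
  rw [this]
  exact add_mem (Ideal.mul_mem_left _ _ hv) (Ideal.mul_mem_left _ _ h3)

/-- Comparing unit balls is enough later and avoids matching the normalisations of `w` and `‖σ ·‖`.
-/
theorem FinitePlace.exists_embedding {K : Type*} [Field K] [NumberField K]
    (w : FinitePlace K) (hw : w p < 1) :
    ∃ σ : K →+* ℂ_[p], ∀ y : K, ‖σ y‖ ≤ 1 → w y ≤ 1 := by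
  obtain ⟨σ, hσ⟩ := exists_primeOfEmbedding_eq (p := p) w.maximalIdeal (by
    rw [← FinitePlace.norm_lt_one_iff_mem K, FinitePlace.norm_embedding_eq]
    simpa using hw)
  refine ⟨σ, fun y hy ↦ ?_⟩
  by_contra! hwy
  have hint (z : 𝓞 K) (hz : z ∉ w.maximalIdeal.asIdeal) : w z = 1 := by
    rw [← FinitePlace.norm_embedding_eq]
    exact (FinitePlace.norm_eq_one_iff_notMem K _ z).2 hz
  have hle (z : 𝓞 K) : w z ≤ 1 := by
    rw [← FinitePlace.norm_embedding_eq]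
    exact FinitePlace.norm_le_one K _ z
  obtain ⟨n, d, h | h⟩ := w.maximalIdeal.exists_primeCompl_mul_eq_or_mul_eq y
  · have h1 := congrArg w h
    rw [map_mul, hint d d.2, mul_one] at h1
    exact ((hle n).trans_lt hwy).ne' h1
  · have h1 := congrArg w h
    rw [map_mul, hint d d.2] at h1
    have h2 : w n < 1 := by
      by_contra! h3
      nlinarith
    have h3 : n ∈ primeOfEmbedding σ := by
      rw [← hσ, ← FinitePlace.norm_lt_one_iff_mem K, FinitePlace.norm_embedding_eq]
      exact h2
    have h4 : (d : 𝓞 K) ∉ primeOfEmbedding σ := hσ ▸ d.2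
    rw [mem_primeOfEmbedding] at h3 h4
    have h5 := congrArg (‖σ ·‖) h
    simp only [map_mul, norm_mul] at h5
    refine h4 (h5 ▸ ?_)
    exact (mul_le_of_le_one_left (norm_nonneg _) hy).trans_lt h3

/-! ### Exponents making `x ^ a - x ^ b` uniformly small -/

theorem exists_norm_pow_sub_pow_le {C : Type*} [NormedField C] [IsUltrametricDist C] {B : Set C}
    (hB : IsCompact B) (hB1 : ∀ x ∈ B, ‖x‖ ≤ 1) (hpow : ∀ x ∈ B, ∀ n : ℕ, x ^ n ∈ B)
    {ε : ℝ} (hε : 0 < ε) : ∃ a b : ℕ, b < a ∧ ∀ x ∈ B, ‖x ^ a - x ^ b‖ ≤ ε := by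
  obtain ⟨t, htB, htf, hcov⟩ := hB.finite_cover_balls hε
  have hr (x : B) : ∃ s : t, ‖(x : C) - s‖ < ε := by
    have := hcov x.2
    simp only [Set.mem_iUnion, Metric.mem_ball, dist_eq_norm] at this
    obtain ⟨s, hs, hxs⟩ := this
    exact ⟨⟨s, hs⟩, hxs⟩
  choose r hr using hr
  have : Finite t := htf
  -- Pigeonhole: each exponent induces a self-map of the finite net `t`, and there are finitely many
  -- such maps. Powers do not increase distances on the ultrametric unit ball, so agreement on the
  -- net passes to all of `B`.
  obtain ⟨m, n, hmn, heq⟩ := Finite.exists_ne_map_eq_of_infinite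
    (fun (n : ℕ) (s : t) ↦ r ⟨(s : C) ^ n, hpow _ (htB s.2) n⟩)
  have ultra {x y z : C} (h1 : ‖x - y‖ ≤ ε) (h2 : ‖y - z‖ ≤ ε) : ‖x - z‖ ≤ ε := by
    rw [← sub_add_sub_cancel x y z]
    exact (IsUltrametricDist.norm_add_le_max _ _).trans (max_le h1 h2)
  have hp (x s : C) (hx : ‖x‖ ≤ 1) (hs : ‖s‖ ≤ 1) (h : ‖x - s‖ ≤ ε) (n : ℕ) :
      ‖x ^ n - s ^ n‖ ≤ ε := by
    induction n with
    | zero => simpa using hε.le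
    | succ n ih =>
      refine ultra (y := x * s ^ n) ?_ ?_
      · rw [pow_succ', ← mul_sub, norm_mul]
        exact (mul_le_of_le_one_left (norm_nonneg _) hx).trans ih
      · rw [pow_succ', ← sub_mul, norm_mul, norm_pow]
        exact (mul_le_of_le_one_right (norm_nonneg _) (pow_le_one₀ (norm_nonneg _) hs)).trans h
  have hmain (x : C) (hx : x ∈ B) : ‖x ^ m - x ^ n‖ ≤ ε := by
    set s := r ⟨x, hx⟩
    have hxs := (hr ⟨x, hx⟩).le
    have h1 (k : ℕ) : ‖x ^ k - r ⟨(s : C) ^ k, hpow _ (htB s.2) k⟩‖ ≤ ε :=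
      ultra (hp _ _ (hB1 x hx) (hB1 _ (htB s.2)) hxs k) (hr ⟨(s : C) ^ k, _⟩).le
    have h2 := h1 n
    rw [← congrFun heq s, norm_sub_rev] at h2
    exact ultra (h1 m) h2
  rcases hmn.lt_or_gt with h | h
  · exact ⟨n, m, h, fun x hx ↦ by rw [norm_sub_rev]; exact hmain x hx⟩
  · exact ⟨m, n, h, hmain⟩

/-- Outside the unit ball the bound is applied to `x⁻¹`; clearing denominators produces the exponent
`a + b`. -/
theorem exists_norm_pow_sub_pow_le_max (L : IntermediateField ℚ_[p] ℂ_[p])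
    [FiniteDimensional ℚ_[p] L] {ε : ℝ} (hε : 0 < ε) :
    ∃ a b : ℕ, b < a ∧ ∀ x ∈ L, ‖x ^ a - x ^ b‖ ≤ ε * max ‖x‖ 1 ^ (a + b) := by
  have hB : IsCompact {x : ℂ_[p] | x ∈ L ∧ ‖x‖ ≤ 1} := by
    have : ProperSpace L.toSubmodule := FiniteDimensional.proper ℚ_[p] _
    have h := (isCompact_closedBall (0 : L.toSubmodule) 1).image continuous_subtype_val
    convert h using 1
    ext x
    simp [and_comm]
  obtain ⟨a, b, hba, h⟩ := exists_norm_pow_sub_pow_le hB (fun x hx ↦ hx.2) (fun x hx n ↦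
    ⟨pow_mem hx.1 n, by rw [norm_pow]; exact pow_le_one₀ (norm_nonneg _) hx.2⟩) hε
  refine ⟨a, b, hba, fun x hx ↦ ?_⟩
  rcases le_or_gt ‖x‖ 1 with h1 | h1
  · rw [max_eq_right h1, one_pow, mul_one]
    exact h x ⟨hx, h1⟩
  · rw [max_eq_left h1.le]
    have hx0 : x ≠ 0 := by rintro rfl; simp at h1; linarith
    have h2 := h x⁻¹ ⟨inv_mem hx, by rw [norm_inv]; exact inv_le_one_of_one_le₀ h1.le⟩
    have h3 : x ^ a - x ^ b = -((x⁻¹ ^ a - x⁻¹ ^ b) * x ^ (a + b)) := by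
      rw [pow_add, inv_pow, inv_pow]
      field_simp
      ring
    rw [h3, norm_neg, norm_mul, norm_pow]
    gcongr

/-! ### The totally `p`-adic case and conclusion -/

theorem log_two_div_le_of_totally_padic {L : Subfield ℂ_[p]} {a b : ℕ} (hba : b < a)
    (hL : ∀ x ∈ L, ‖x ^ a - x ^ b‖ ≤ ‖(p : ℂ_[p]) ^ 2‖ * max ‖x‖ 1 ^ (a + b))
    {α : AlgebraicClosure ℚ} (hα : IsTotally L α) (h : α ^ a ≠ α ^ b) :
    Real.log 2 / (a + b : ℕ) ≤ absLogHeight₁ α := by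
  refine log_two_div_le_absLogHeight₁ (by omega) ?_
  intro _
  set x := IntermediateField.AdjoinSimple.gen ℚ α
  have hx : algebraMap _ (AlgebraicClosure ℚ) x = α :=
    IntermediateField.AdjoinSimple.algebraMap_gen ℚ α
  have hβ : x ^ a - x ^ b ≠ 0 := fun h0 ↦ h <| by
    rw [← hx, ← map_pow, ← map_pow, sub_eq_zero.1 h0]
  have hp2 : (2 : ℝ) ≤ p := by exact_mod_cast (Fact.out : p.Prime).two_le
  -- The triangle inequality costs 2 at infinite places; `p ^ 2 ≥ 4 = 2 * C` pays for it, which is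
  -- why the local bound is `‖p ^ 2‖`.
  refine two_le_mulHeight_pow hβ (C := 2) (g := p ^ 2) (by norm_num)
    (by push_cast; nlinarith) (fun w ↦ ?_) fun w ↦ ?_
  · have key (n : ℕ) (hn : n ≤ a + b) : w (x ^ n) ≤ max (w x) 1 ^ (a + b) := by
      rw [map_pow]
      exact (pow_le_pow_left₀ (apply_nonneg w x) (le_max_left _ 1) n).trans
        (pow_le_pow_right₀ (le_max_right _ _) hn)
    rw [← InfinitePlace.norm_embedding_eq, map_sub]
    refine (norm_sub_le _ _).trans ?_
    rw [InfinitePlace.norm_embedding_eq, InfinitePlace.norm_embedding_eq]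
    linarith [key a (by omega), key b (by omega)]
  · have hwp : w (p : IntermediateField.adjoin ℚ {α}) ≤ 1 := by
      have := FinitePlace.norm_le_one (IntermediateField.adjoin ℚ {α}) w.maximalIdeal
        (p : 𝓞 (IntermediateField.adjoin ℚ {α}))
      rw [FinitePlace.norm_embedding_eq] at this
      simpa using this
    rcases hwp.lt_or_eq with hw | hw
    · obtain ⟨σ, hσ⟩ := FinitePlace.exists_embedding w hw
      have h1 := hL _ (hα.apply_gen_mem σ)
      rw [Nat.cast_pow]
      have hp0 : (p : IntermediateField.adjoin ℚ {α}) ≠ 0 := by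
        exact_mod_cast (Fact.out : p.Prime).ne_zero
      -- Realising the maximum by an element `m` of the field (`1` or `x`) turns the local estimate
      -- into `‖σ y‖ ≤ 1` for a quotient `y`, which transfers to `w`.
      obtain ⟨m, hm0, hmσ, hmw⟩ : ∃ m : IntermediateField.adjoin ℚ {α}, m ≠ 0 ∧
          max ‖σ x‖ 1 = ‖σ m‖ ∧ w m ≤ max (w x) 1 := by
        rcases le_or_gt ‖σ x‖ 1 with h2 | h2
        · exact ⟨1, one_ne_zero, by simpa using h2, by simp⟩
        · refine ⟨x, ?_, max_eq_left h2.le, le_max_left _ _⟩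
          intro h0
          rw [h0] at h2
          simp at h2
          linarith
      have hden : (p : IntermediateField.adjoin ℚ {α}) ^ 2 * m ^ (a + b) ≠ 0 :=
        mul_ne_zero (pow_ne_zero _ hp0) (pow_ne_zero _ hm0)
      have h2 := hσ ((x ^ a - x ^ b) / (p ^ 2 * m ^ (a + b))) (by
        rw [map_div₀, norm_div]
        refine div_le_one_of_le₀ ?_ (norm_nonneg _)
        rw [map_mul, norm_mul, map_pow, map_pow, norm_pow (σ m), ← hmσ, map_natCast, map_sub,
          map_pow, map_pow]
        exact h1)
      rw [map_div₀, div_le_one (FinitePlace.pos_iff.2 hden), map_mul, map_pow _ m] at h2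
      refine h2.trans ?_
      gcongr
    · rw [Nat.cast_pow, map_pow _ (p : IntermediateField.adjoin ℚ {α}), hw, one_pow, one_mul]
      exact FinitePlace.apply_pow_sub_pow_le w x (by omega) (by omega)

end padic
theorem mainTheorem4 :
    (0 < liminfOver (totallyPoints realSubfield) weilHeightP1 ∧
      ∃ c : ℝ, 0 < c ∧ ∀ α : AlgebraicClosure ℚ, IsTotally realSubfield α →
        α ≠ 0 → (∀ n : ℕ, 0 < n → α ^ n ≠ 1) → c ≤ NumberField.absLogHeight₁ α) ∧
    (∀ (p : ℕ) [Fact p.Prime] (L : IntermediateField ℚ_[p] ℂ_[p])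
        [FiniteDimensional ℚ_[p] L] [IsGalois ℚ_[p] L],
      0 < liminfOver (totallyPoints L.toSubfield) weilHeightP1 ∧
      ∃ c : ℝ, 0 < c ∧ ∀ α : AlgebraicClosure ℚ, IsTotally L.toSubfield α →
        α ≠ 0 → (∀ n : ℕ, 0 < n → α ^ n ≠ 1) → c ≤ NumberField.absLogHeight₁ α) := by
  refine ⟨?_, fun p _ L _ _ ↦ ?_⟩
  · refine liminfOver_pos_and_exists_bound realSubfield (a := 3) (b := 1) (by norm_num)
      (c := Real.log 2 / 4) (by positivity) fun α hα h ↦ log_two_div_four_le_of_totally_real hα h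
  · have hp : (p : ℂ_[p]) ≠ 0 := by exact_mod_cast (Fact.out : p.Prime).ne_zero
    obtain ⟨a, b, hba, hL⟩ := exists_norm_pow_sub_pow_le_max L (norm_pos_iff.2 (pow_ne_zero 2 hp))
    have hab : (0 : ℝ) < (a + b : ℕ) := by exact_mod_cast (by omega : 0 < a + b)
    exact liminfOver_pos_and_exists_bound L.toSubfield hba
      (div_pos (Real.log_pos one_lt_two) hab) fun α hα h ↦
        log_two_div_le_of_totally_padic hba hL hα h
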